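/- **Setting.** For each $n\ge 1$ let $(Z_n,\mathscr Z_n)$ be a standard Borel space with a $\sigma$-finite measure $\mu_n$ without atoms (the case where $(Z_n,\mu_n)=(Z,\mu)$ does not depend on $n$ is included). Let $\Omega_n$ be the set of all measures $\omega=\sum_{j=1}^{N}\delta_{z_j}$ with $N\in\{0,1,2,\dots\}\cup\{\infty\}$ and $z_j\in Z_n$, with the $\sigma$-field generated by the maps $\eta_n(B):\omega\mapsto\omega(B)$, and let $\mathbb P_n$ be a probability on $\Omega_n$ under which $\eta_n$ is a Poisson measure with control $\mu_n$: for pairwise disjoint $B_1,\dots,B_k$ of finite $\mu_n$-measure the variables $\eta_n(B_1),\dots,\eta_n(B_k)$ are independent, and $\eta_n(B)$ is Poisson distributed with mean $\mu_n(B)$ whenever $\mu_n(B)<\infty$. We drop the index $n$ in the following definitions. Put $\hat\eta=\eta-\mu$ and let $I_q(f)$, $f\in L^2(\mu^q)$, be the multiple Wiener–Itô integral of order $q$ with respect to $\hat\eta$, that is, the continuous linear extension to $L^2(\mu^q)$, with values in $L^2(\mathbb P)$, of $\mathbf 1_{A_1\times\cdots\times A_q}\mapsto\prod_{i}\hat\eta(A_i)$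 ($A_1,\dots,A_q$ pairwise disjoint and of finite measure), with $I_0(b)=b$. Every $F\in L^2(\mathbb P)$ is $F=\mathbb E[F]+\sum_{k\ge1}I_k(f_k)$ in $L^2(\mathbb P)$, with unique symmetric $f_k\in L^2(\mu^k)$. One says that $F\in\mathrm{dom}\,D$ if $\sum_{k\ge1} k\,k!\,\|f_k\|^2_{L^2(\mu^k)}<\infty$; then the Malliavin derivative is $D_zF=\sum_{k\ge1}k\,I_{k-1}(f_k(z,\cdot))$, with convergence in $L^2(\mathbb P\otimes\mu)$. If $\mathbb E[F]=0$, then $L^{-1}F=-\sum_{k\ge1}\frac1k I_k(f_k)$. **Proposition 2.2.** Let $d,m\ge 0$ be integers. For every $n$, let $\mathbf F_{d,n}=(F_n^{(1)},\dots,F_n^{(d)})$ be a vector of elements of $\mathrm{dom}\,D$ with values in $\{0,1,2,\dots\}$, and let $\mathbf G_{m,n}=(G_n^{(1)},\dots,G_n^{(m)})$ be a vector of centered elements of $\mathrm{dom}\,D$, all defined on $(\Omega_n,\mathbb P_n)$. Suppose that * for every $i=1,\dots,d$, the sequence $n\mapsto\mathbb E\left[\int_{Z_n}(D_zF_n^{(i)})^2\,\mu_n(dz)\right]$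 is bounded; * there is $\epsilon>1$ such that, for every $j=1,\dots,m$, $\lim_{n\to\infty}\mathbb E\left[\int_{Z_n}|D_zL^{-1}G_n^{(j)}|^{1+\epsilon}\,\mu_n(dz)\right]=0$. Then $$\beta(\mathbf F_{d,n},\mathbf G_{m,n}):=\sum_{i=1}^d\sum_{j=1}^m\mathbb E\left[\int_{Z_n}|D_zL^{-1}G_n^{(j)}|\,|D_zF_n^{(i)}|\,\mu_n(dz)\right]\longrightarrow 0\qquad(n\to\infty).$$ -/

import Mathlib

open MeasureTheory ProbabilityTheory Filter Topology
open scoped ENNReal NNReal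

noncomputable section

namespace PoissonSpace

variable {Z : Type*} [MeasurableSpace Z]

/-- The canonical space of point configurations: measures `∑_{j < n} δ_{z_j}` with
`n ∈ ℕ ∪ {∞}`. It carries the σ-field generated by the evaluations `ω ↦ ω B`, `B` measurable
(for a σ-finite control measure `μ` this is the σ-field generated by those `B` with
`μ B < ∞`). -/
abbrev Config (Z : Type*) [MeasurableSpace Z] : Type _ :=
  {ω : Measure Z // ∃ (n : ℕ∞) (z : {j : ℕ // (j : ℕ∞) < n} → Z),
    ω = Measure.sum fun j => Measure.dirac (z j)}

/-- Under `P`, the canonical mapping `η(B)(ω) = ω(B)` is a Poisson measure with control `μ`: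
it is independently scattered, and `η(B)` has the Poisson law of mean `μ(B)`. -/
structure IsPoissonMeasure (μ : Measure Z) (P : Measure (Config Z)) : Prop where
  indep : ∀ (k : ℕ) (B : Fin k → Set Z), (∀ i, MeasurableSet (B i)) → (∀ i, μ (B i) < ∞) →
    Pairwise (fun i j => Disjoint (B i) (B j)) →
      iIndepFun (fun (i : Fin k) (ω : Config Z) => ω.1 (B i)) P
  law : ∀ B : Set Z, MeasurableSet B → μ B < ∞ →
    P.map (fun ω : Config Z => ω.1 B) =
      (poissonMeasure (μ B).toNNReal).map (fun n : ℕ => (n : ℝ≥0∞))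

/-- The compensated measure `η̂(B) = η(B) - μ(B)`. -/
def compensated (μ : Measure Z) (B : Set Z) (ω : Config Z) : ℝ := ω.1.real B - μ.real B

/-- The product measure `μ^q` on `Z^q`. -/
abbrev powMeasure (μ : Measure Z) (q : ℕ) : Measure (Fin q → Z) :=
  Measure.pi fun _ : Fin q => μ

/-- A finite linear combination of indicators of boxes `A_1 × ⋯ × A_q` whose sides are
pairwise disjoint sets of finite measure; such functions vanish on diagonals. -/
structure Elementary (μ : Measure Z) (q : ℕ) where
  card : ℕ
  coeff : Fin card → ℝ
  side : Fin card → Fin q → Set Z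
  measurableSet_side : ∀ i j, MeasurableSet (side i j)
  side_lt_top : ∀ i j, μ (side i j) < ∞
  disjoint_side : ∀ i, Pairwise fun j l => Disjoint (side i j) (side i l)

/-- The function on `Z^q` represented by an elementary integrand. -/
def Elementary.toFun {μ : Measure Z} {q : ℕ} (g : Elementary μ q) (x : Fin q → Z) : ℝ :=
  ∑ i, g.coeff i * ∏ j, (g.side i j).indicator (fun _ => (1 : ℝ)) (x j)

/-- The multiple integral of an elementary integrand: `1_{A_1 × ⋯ × A_q}` is mapped to
`η̂(A_1) ⋯ η̂(A_q)`. -/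
def Elementary.integral {μ : Measure Z} {q : ℕ} (g : Elementary μ q) (ω : Config Z) : ℝ :=
  ∑ i, g.coeff i * ∏ j, compensated μ (g.side i j) ω

/-- `X = I_q(f)`, the multiple Wiener–Itô integral of order `q` of `f ∈ L²(μ^q)`: the
`L²(P)`-limit of the integrals of elementary integrands converging to `f` in `L²(μ^q)`.
For `q = 0` this says that `X` is almost surely the constant `f`. -/
structure IsMultipleIntegral (μ : Measure Z) (P : Measure (Config Z)) (q : ℕ)
    (f : (Fin q → Z) → ℝ) (X : Config Z → ℝ) : Prop where
  memLp_kernel : MemLp f 2 (powMeasure μ q)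
  memLp : MemLp X 2 P
  exists_approx : ∃ g : ℕ → Elementary μ q,
    Tendsto (fun n => eLpNorm (fun x => (g n).toFun x - f x) 2 (powMeasure μ q)) atTop (𝓝 0) ∧
    Tendsto (fun n => eLpNorm (fun ω => (g n).integral ω - X ω) 2 P) atTop (𝓝 0)

/-- The series `∑_{k ≥ 0} S_k` converges to `X` in `L²(ν)`. -/
def HasSumL2 {α : Type*} [MeasurableSpace α] (ν : Measure α) (S : ℕ → α → ℝ) (X : α → ℝ) :
    Prop :=
  Tendsto (fun N : ℕ => eLpNorm (fun a => (∑ k ∈ Finset.range N, S k a) - X a) 2 ν) atTop (𝓝 0)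

/-- `f ∈ L²_s(μ^k)`: square integrable and almost everywhere symmetric. -/
def IsSymmKernel (μ : Measure Z) (k : ℕ) (f : (Fin k → Z) → ℝ) : Prop :=
  MemLp f 2 (powMeasure μ k) ∧
    ∀ σ : Equiv.Perm (Fin k), (fun x => f (x ∘ σ)) =ᵐ[powMeasure μ k] f

/-- The chaotic decomposition `F = E[F] + ∑_{k ≥ 1} I_k(f_k)` in `L²(P)` with symmetric kernels
`f_k`; here `J k` is (a version of) `I_{k+1}(f_{k+1})`. The value of `f 0` plays no role. -/
structure HasChaos (μ : Measure Z) (P : Measure (Config Z)) (F : Config Z → ℝ)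
    (f : (k : ℕ) → (Fin k → Z) → ℝ) (J : ℕ → Config Z → ℝ) : Prop where
  memLp : MemLp F 2 P
  symm : ∀ k, IsSymmKernel μ (k + 1) (f (k + 1))
  integral : ∀ k, IsMultipleIntegral μ P (k + 1) (f (k + 1)) (J k)
  hasSum : HasSumL2 P J (fun ω => F ω - ∫ ω', F ω' ∂P)

/-- The condition `∑_{k ≥ 1} k k! ‖f_k‖² < ∞` on a family of kernels. -/
def DerivSummable (μ : Measure Z) (f : (k : ℕ) → (Fin k → Z) → ℝ) : Prop :=
  Summable fun k : ℕ =>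
    ((k + 1 : ℕ) : ℝ) * ((k + 1).factorial : ℝ) * ∫ x, (f (k + 1) x) ^ 2 ∂(powMeasure μ (k + 1))

/-- The domain of the Malliavin derivative. -/
def domD (μ : Measure Z) (P : Measure (Config Z)) : Set (Config Z → ℝ) :=
  {F | ∃ f J, HasChaos μ P F f J ∧ DerivSummable μ f}

/-- `u` is (a version of) the Malliavin derivative of `F`: an element of `L²(P ⊗ μ)` with
`u_z = ∑_{k ≥ 1} k I_{k-1}(f_k(z, ·))`, the series converging in `L²(P ⊗ μ)`. Here `v k` is a
jointly measurable version of `(ω, z) ↦ I_k(f_{k+1}(z, ·))(ω)`. -/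
def IsMalliavinDeriv (μ : Measure Z) (P : Measure (Config Z)) (F : Config Z → ℝ)
    (u : Config Z → Z → ℝ) : Prop :=
  ∃ f J, HasChaos μ P F f J ∧ DerivSummable μ f ∧
    MemLp (fun p : Config Z × Z => u p.1 p.2) 2 (P.prod μ) ∧
    ∃ v : ℕ → Config Z → Z → ℝ,
      (∀ k, MemLp (fun p : Config Z × Z => v k p.1 p.2) 2 (P.prod μ)) ∧
      (∀ k, ∀ᵐ z ∂μ,
        IsMultipleIntegral μ P k (fun y => f (k + 1) (Fin.cons z y)) (fun ω => v k ω z)) ∧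
      HasSumL2 (P.prod μ) (fun k p => ((k + 1 : ℕ) : ℝ) * v k p.1 p.2) (fun p => u p.1 p.2)

open Classical in
/-- The Malliavin derivative `(ω, z) ↦ D_z F(ω)` of `F ∈ dom D` (a fixed version; it is unique
up to `P ⊗ μ`-null sets). -/
def malliavinD (μ : Measure Z) (P : Measure (Config Z)) (F : Config Z → ℝ) :
    Config Z → Z → ℝ :=
  if h : ∃ u, IsMalliavinDeriv μ P F u then h.choose else fun _ _ => 0

/-- `X` is (a version of) `L⁻¹ G = -∑_{k ≥ 1} (1/k) I_k(g_k)`, where `G` is centered with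
chaotic decomposition `G = ∑_{k ≥ 1} I_k(g_k)`. -/
def IsPseudoInverse (μ : Measure Z) (P : Measure (Config Z)) (G X : Config Z → ℝ) : Prop :=
  (∫ ω, G ω ∂P = 0) ∧ ∃ g J, HasChaos μ P G g J ∧ MemLp X 2 P ∧
    HasSumL2 P (fun k ω => -(((k + 1 : ℕ) : ℝ)⁻¹ * J k ω)) X

open Classical in
/-- The pseudo-inverse `L⁻¹` of the Ornstein–Uhlenbeck generator on centered elements of
`L²(P)` (a fixed version; it is unique up to `P`-null sets). -/
def pseudoInverseL (μ : Measure Z) (P : Measure (Config Z)) (G : Config Z → ℝ) :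
    Config Z → ℝ :=
  if h : ∃ X, IsPseudoInverse μ P G X then h.choose else fun _ => 0

/-- `E ∫_Z |u_z|^p μ(dz)` as an extended nonnegative number. -/
def expMoment (μ : Measure Z) (P : Measure (Config Z)) (p : ℝ) (u : Config Z → Z → ℝ) : ℝ≥0∞ :=
  ∫⁻ ω, ∫⁻ z, ENNReal.ofReal (|u ω z| ^ p) ∂μ ∂P

/-- The mixed term `β(F, G) = ∑_i ∑_j E ⟨|D L⁻¹ G_j|, |D F_i|⟩_{L²(μ)}`, as an extended
nonnegative number. -/
def beta (μ : Measure Z) (P : Measure (Config Z)) {d m : ℕ}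
    (F : Fin d → Config Z → ℝ) (G : Fin m → Config Z → ℝ) : ℝ≥0∞ :=
  ∑ i, ∑ j, ∫⁻ ω, ∫⁻ z,
    ENNReal.ofReal (|malliavinD μ P (pseudoInverseL μ P (G j)) ω z| * |malliavinD μ P (F i) ω z|)
      ∂μ ∂P

end PoissonSpace

end

/-! The Malliavin derivative on the Poisson space is the add-one cost: `D_z F(ω) = F(ω + δ_z) -
F(ω)` for `P ⊗ μ`-almost every `(ω, z)`. Hence an integer-valued `F` has an integer-valued
derivative. For an integer `k` and `ε > 1` one has `|k|^((1+ε)/ε) ≤ k²`, because `(1+ε)/ε ≤ 2`.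
Hölder's inequality with exponents `1+ε` and `(1+ε)/ε` then bounds each term of `beta` by `(E∫|D
L⁻¹G|^(1+ε))^(1/(1+ε)) * (E∫|DF|²)^(ε/(1+ε))`: the first factor tends to zero and the second is
bounded (`lintegral_mul_le_of_int`).

Since `D` is defined through chaos expansions, the work lies in identifying it with the add-one cost
(`IsMalliavinDeriv.ae_eq_addPoint_sub`). Three facts carry this. The Mecke formula
(`IsPoissonMeasure.mecke`) implies that `addPoint` pulls `P`-null sets back to `P ⊗ μ`-null sets, so
almost sure limits may be evaluated at `ω + δ_z`. For elementary integrands the identity is algebra: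
the sides of a box are disjoint, so a new point meets at most one of them
(`Elementary.integral_addPoint`). The bound `E[I_k(g)²] ≤ k! ‖g‖²`
(`IsPoissonMeasure.integral_sq_le`), obtained from Mecke by integration by parts, carries the
identity to `L²` limits. -/

namespace PoissonSpace

variable {Z : Type*} [MeasurableSpace Z]

/-! ### Adding a point, and the Mecke formula for finite-dimensional laws. -/

/-- Adding a point to a configuration. -/
noncomputable def addPoint (p : Config Z × Z) : Config Z :=
  ⟨p.1.1 + Measure.dirac p.2, by
    obtain ⟨n, z, hz⟩ := p.1.2
    have hlt : ∀ j : ℕ, ((j + 1 : ℕ) : ℕ∞) < n + 1 ↔ (j : ℕ∞) < n := fun j => by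
      rw [Nat.cast_add, Nat.cast_one]
      exact ENat.add_lt_add_iff_right (by simp)
    -- Old atoms move up one index and the new atom takes index 0; this also covers `n = ⊤`, where
    -- `n + 1 = n`.
    let e : Option {j : ℕ // (j : ℕ∞) < n} ≃ {j : ℕ // (j : ℕ∞) < n + 1} :=
      { toFun := fun o => o.elim ⟨0, by simp⟩ fun j => ⟨j.1 + 1, (hlt j.1).2 j.2⟩
        invFun := fun j => match j with
          | ⟨0, _⟩ => none
          | ⟨j + 1, h⟩ => some ⟨j, (hlt j).1 h⟩
        left_inv := by rintro (_ | j) <;> rfl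
        right_inv := by rintro ⟨_ | j, h⟩ <;> rfl }
    refine ⟨n + 1, fun j => (e.symm j).elim p.2 z, ?_⟩
    ext B hB
    rw [hz, Measure.add_apply, Measure.sum_apply _ hB, Measure.sum_apply _ hB, ← e.tsum_eq]
    simp only [Equiv.symm_apply_apply]
    rw [← (Equiv.optionEquivSumPUnit.{0} _).symm.tsum_eq,
      ENNReal.summable.tsum_sum ENNReal.summable]
    simp⟩

lemma addPoint_apply (p : Config Z × Z) (B : Set Z) :
    (addPoint p).1 B = p.1.1 B + Measure.dirac p.2 B := rfl

lemma measurable_config_apply {B : Set Z} (hB : MeasurableSet B) :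
    Measurable fun ω : Config Z => ω.1 B :=
  (Measure.measurable_coe hB).comp measurable_subtype_coe

lemma measurable_addPoint : Measurable (addPoint (Z := Z)) := by
  refine Measurable.subtype_mk (Measure.measurable_of_measurable_coe _ fun B hB => ?_)
  simp only [Measure.add_apply]
  exact ((measurable_config_apply hB).comp measurable_fst).add
    ((Measure.measurable_coe hB).comp (Measure.measurable_dirac.comp measurable_snd))

lemma prod_indicator_one {ι α M : Type*} [Fintype ι] [CommMonoidWithZero M] (T : ι → Set α)
    (x : ι → α) : ∏ i, (T i).indicator (fun _ => (1 : M)) (x i) =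
      (Set.pi Set.univ T).indicator (fun _ => 1) x := by
  by_cases hx : x ∈ Set.pi Set.univ T
  · rw [Set.indicator_of_mem hx]
    exact Finset.prod_eq_one fun i _ => Set.indicator_of_mem (hx i trivial) _
  · rw [Set.indicator_of_notMem hx]
    simp only [Set.mem_pi, Set.mem_univ, true_implies, not_forall] at hx
    obtain ⟨i, hi⟩ := hx
    exact Finset.prod_eq_zero (Finset.mem_univ i) (Set.indicator_of_notMem hi _)

/-- The size-biased Poisson law is the Poisson law shifted by one. -/
lemma lintegral_cast_mul_poissonMeasure (r : ℝ≥0) (h : ℕ → ℝ≥0∞) :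
    ∫⁻ n : ℕ, (n : ℝ≥0∞) * h n ∂poissonMeasure r = r * ∫⁻ n, h (n + 1) ∂poissonMeasure r := by
  simp only [poissonMeasure, lintegral_sum_measure, lintegral_smul_measure, lintegral_dirac,
    smul_eq_mul]
  -- The term at 0 vanishes; for the others, `(n+1) r^(n+1)/(n+1)! = r * r^n/n!`.
  rw [tsum_eq_zero_add' ENNReal.summable, ← ENNReal.tsum_mul_left]
  simp only [Nat.cast_zero, zero_mul, mul_zero, zero_add]
  refine tsum_congr fun n => ?_
  rw [← mul_assoc, ← mul_assoc]
  congr 1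
  rw [← ENNReal.ofReal_natCast, ← ENNReal.ofReal_coe_nnreal,
    ← ENNReal.ofReal_mul (by positivity), ← ENNReal.ofReal_mul (by positivity)]
  congr 1
  rw [Nat.factorial_succ]
  push_cast
  field_simp
  ring

variable {μ : Measure Z} {P : Measure (Config Z)}

lemma IsPoissonMeasure.lintegral_comp (hP : IsPoissonMeasure μ P) {B : Set Z}
    (hB : MeasurableSet B) (hμB : μ B < ∞) {h : ℝ≥0∞ → ℝ≥0∞} (hh : Measurable h) :
    ∫⁻ ω, h (ω.1 B) ∂P = ∫⁻ n : ℕ, h n ∂poissonMeasure (μ B).toNNReal := by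
  rw [← lintegral_map hh (measurable_config_apply hB), hP.law B hB hμB,
    lintegral_map hh .of_discrete]

lemma IsPoissonMeasure.ae_lt_top (hP : IsPoissonMeasure μ P) {B : Set Z}
    (hB : MeasurableSet B) (hμB : μ B < ∞) : ∀ᵐ ω ∂P, ω.1 B < ∞ := by
  have h : ∀ᵐ x ∂(P.map fun ω : Config Z => ω.1 B), x < ∞ := by
    rw [hP.law B hB hμB, ae_map_iff Measurable.of_discrete.aemeasurable measurableSet_Iio]
    exact ae_of_all _ fun n => ENNReal.natCast_lt_top n
  exact ae_of_ae_map (measurable_config_apply hB).aemeasurable h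

lemma IsPoissonMeasure.lintegral_apply_mul_comp (hP : IsPoissonMeasure μ P) {B : Set Z}
    (hB : MeasurableSet B) (hμB : μ B < ∞) {h : ℝ≥0∞ → ℝ≥0∞} (hh : Measurable h) :
    ∫⁻ ω, ω.1 B * h (ω.1 B) ∂P = μ B * ∫⁻ ω, h (ω.1 B + 1) ∂P := by
  rw [hP.lintegral_comp hB hμB (h := fun x => x * h x) (by fun_prop),
    hP.lintegral_comp hB hμB (h := fun x => h (x + 1)) (by fun_prop),
    lintegral_cast_mul_poissonMeasure _ (fun n => h n), ENNReal.coe_toNNReal hμB.ne]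
  simp

/-- By independence both sides factorise, and only the factor of index `s` is size-biased. -/
lemma IsPoissonMeasure.lintegral_prod_mul (hP : IsPoissonMeasure μ P) {r : ℕ}
    {C : Fin r → Set Z} (hC : ∀ i, MeasurableSet (C i)) (hμC : ∀ i, μ (C i) < ∞)
    (hd : Pairwise fun i j => Disjoint (C i) (C j)) (s : Fin r) {h : Fin r → ℝ≥0∞ → ℝ≥0∞}
    (hh : ∀ i, Measurable (h i)) :
    ∫⁻ ω, ω.1 (C s) * ∏ i, h i (ω.1 (C i)) ∂P =
      μ (C s) * ∫⁻ ω, ∏ i, h i (ω.1 (C i) + if i = s then 1 else 0) ∂P := by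
  have hind := hP.indep r C hC hμC hd
  have hprod : ∀ k : Fin r → ℝ≥0∞ → ℝ≥0∞, (∀ i, Measurable (k i)) →
      ∫⁻ ω, ∏ i, k i (ω.1 (C i)) ∂P = ∏ i, ∫⁻ ω, k i (ω.1 (C i)) ∂P := fun k hk =>
    lintegral_prod_eq_prod_lintegral_of_indepFun Finset.univ _ (hind.comp k hk)
      fun i => (hk i).comp (measurable_config_apply (hC i))
  have h1 : ∀ ω : Config Z, ω.1 (C s) * ∏ i, h i (ω.1 (C i)) =
      ∏ i, (if i = s then (fun x => x * h i x) else h i) (ω.1 (C i)) := fun ω => by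
    rw [← Finset.mul_prod_erase Finset.univ _ (Finset.mem_univ s),
      ← Finset.mul_prod_erase Finset.univ _ (Finset.mem_univ s), if_pos rfl, ← mul_assoc]
    congr 1
    exact Finset.prod_congr rfl fun i hi => by rw [if_neg (Finset.ne_of_mem_erase hi)]
  simp_rw [h1]
  rw [hprod (fun i => if i = s then (fun x => x * h i x) else h i)
      (fun i => by split_ifs; exacts [measurable_id.mul (hh i), hh i]),
    hprod (fun i x => h i (x + if i = s then 1 else 0))
      (fun i => (hh i).comp (measurable_id.add_const _)),
    ← Finset.mul_prod_erase Finset.univ _ (Finset.mem_univ s),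
    ← Finset.mul_prod_erase Finset.univ (fun i => ∫⁻ ω, h i (_ + _) ∂P) (Finset.mem_univ s),
    ← mul_assoc]
  simp only [if_true]
  rw [hP.lintegral_apply_mul_comp (hC s) (hμC s) (hh s)]
  congr 1
  exact Finset.prod_congr rfl fun i hi => by simp [Finset.ne_of_mem_erase hi]

variable [IsProbabilityMeasure P]

lemma IsPoissonMeasure.lintegral_apply (hP : IsPoissonMeasure μ P) {B : Set Z}
    (hB : MeasurableSet B) (hμB : μ B < ∞) : ∫⁻ ω, ω.1 B ∂P = μ B := by
  simpa using hP.lintegral_apply_mul_comp hB hμB (h := fun _ => 1) measurable_const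

/-- Mecke formula for finite-dimensional distributions over disjoint sets. -/
lemma IsPoissonMeasure.map_withDensity_apply (hP : IsPoissonMeasure μ P) {r : ℕ}
    {C : Fin r → Set Z} (hC : ∀ i, MeasurableSet (C i)) (hμC : ∀ i, μ (C i) < ∞)
    (hd : Pairwise fun i j => Disjoint (C i) (C j)) (s : Fin r) :
    (P.withDensity fun ω => ω.1 (C s)).map (fun ω i => ω.1 (C i)) =
      μ (C s) • P.map fun ω i => ω.1 (C i) + if i = s then 1 else 0 := by
  have hm : ∀ i, Measurable fun ω : Config Z => ω.1 (C i) :=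
    fun i => measurable_config_apply (hC i)
  have hm1 : Measurable fun (ω : Config Z) i => ω.1 (C i) := measurable_pi_lambda _ hm
  have hm2 : Measurable fun (ω : Config Z) i => ω.1 (C i) + if i = s then 1 else 0 :=
    measurable_pi_lambda _ fun i => (hm i).add_const _
  have hfin : IsFiniteMeasure (P.withDensity fun ω => ω.1 (C s)) :=
    isFiniteMeasure_withDensity (by rw [hP.lintegral_apply (hC s) (hμC s)]; exact (hμC s).ne)
  refine ext_of_generate_finite _ generateFrom_pi.symm isPiSystem_pi ?_ ?_
  · rintro _ ⟨T, hT, rfl⟩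
    have hT' : ∀ i, MeasurableSet (T i) := fun i => hT i trivial
    have hU : MeasurableSet (Set.pi Set.univ T) := MeasurableSet.univ_pi hT'
    have key := hP.lintegral_prod_mul hC hμC hd s
      (h := fun i => (T i).indicator fun _ => 1) fun i => measurable_const.indicator (hT' i)
    have e1 := fun ω : Config Z => prod_indicator_one (M := ℝ≥0∞) T fun i => ω.1 (C i)
    have e2 := fun ω : Config Z => prod_indicator_one (M := ℝ≥0∞) T fun i => ω.1 (C i) + if i = s then 1 else 0
    simp only [e1, e2] at key
    rw [Measure.map_apply hm1 hU, withDensity_apply _ (hm1 hU), Measure.smul_apply, smul_eq_mul,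
      Measure.map_apply hm2 hU, ← lintegral_indicator (hm1 hU), ← lintegral_indicator_one (hm2 hU)]
    refine Eq.trans (lintegral_congr fun ω => ?_) key
    by_cases hω : (fun i => ω.1 (C i)) ∈ Set.pi Set.univ T
    · rw [Set.indicator_of_mem hω, Set.indicator_of_mem (by exact hω)]; simp
    · rw [Set.indicator_of_notMem hω, Set.indicator_of_notMem (by exact hω)]; simp
  · rw [Measure.map_apply hm1 .univ, Measure.smul_apply, Measure.map_apply hm2 .univ]
    simp [hP.lintegral_apply (hC s) (hμC s)]

end PoissonSpace

/-! ### The Mecke formula on configuration space and nonsingularity of adding a point. -/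

namespace PoissonSpace

variable {Z : Type*} [MeasurableSpace Z] {μ : Measure Z} {P : Measure (Config Z)}

/-- A finite family of sets of finite measure is refined by a finite disjoint family. -/
lemma exists_disjoint_refinement {ι : Type*} [Finite ι] {A : ι → Set Z}
    (hA : ∀ i, MeasurableSet (A i)) (hμA : ∀ i, μ (A i) < ∞) :
    ∃ (r : ℕ) (C : Fin r → Set Z), (∀ s, MeasurableSet (C s)) ∧ (∀ s, μ (C s) < ∞) ∧
      (Pairwise fun s t => Disjoint (C s) (C t)) ∧
      ∃ S : ι → Finset (Fin r), ∀ i, A i = ⋃ s ∈ S i, C s := by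
  classical
  have := Fintype.ofFinite ι
  -- Cells are indexed by membership patterns. The all-false pattern is left out: its cell, the
  -- complement of the union, may have infinite measure.
  let κ := {s : ι → Bool // ∃ i, s i = true}
  let C : κ → Set Z := fun s => {z | ∀ i, z ∈ A i ↔ s.1 i = true}
  let e := Fintype.equivFin κ
  refine ⟨Fintype.card κ, fun t => C (e.symm t), fun t => ?_, fun t => ?_, fun t u htu => ?_,
    fun i => Finset.univ.filter fun t => (e.symm t).1 i = true, fun i => ?_⟩
  · have : C (e.symm t) = ⋂ i, {z | z ∈ A i ↔ (e.symm t).1 i = true} := by ext; simp [C]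
    change MeasurableSet (C (e.symm t))
    rw [this]
    exact MeasurableSet.iInter fun i => (hA i).iff (.const _)
  · obtain ⟨i, hi⟩ := (e.symm t).2
    exact (measure_mono fun z hz => (hz i).2 hi).trans_lt (hμA i)
  · refine Set.disjoint_left.2 fun z hz hz' => ?_
    refine htu (e.symm.injective (Subtype.ext (funext fun i => ?_)))
    rw [Bool.eq_iff_iff, ← hz i, ← hz' i]
  · ext z
    simp only [Finset.mem_filter, Finset.mem_univ, true_and, Set.mem_iUnion, exists_prop]
    refine ⟨fun hz => ?_, fun ⟨t, ht, hz⟩ => (hz i).2 ht⟩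
    exact ⟨e ⟨fun j => decide (z ∈ A j), i, by simpa using hz⟩, by simpa using hz, by simp [C]⟩

/-- The Poisson law is prescribed only on sets of finite measure, so uniqueness arguments need these
evaluations to generate. A general `B` is cut into countably many finite pieces along `spanningSets
μ`. -/
lemma measurableSpace_config_eq (μ : Measure Z) [SigmaFinite μ] :
    (inferInstance : MeasurableSpace (Config Z)) =
      ⨆ A : {A : Set Z // MeasurableSet A ∧ μ A < ∞},
        MeasurableSpace.comap (fun ω : Config Z => ω.1 A.1) inferInstance := by
  refine le_antisymm ?_ (iSup_le fun A => (measurable_config_apply A.2.1).comap_le)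
  set m := ⨆ A : {A : Set Z // MeasurableSet A ∧ μ A < ∞},
    MeasurableSpace.comap (fun ω : Config Z => ω.1 A.1) inferInstance with hm
  suffices h : Measurable[m] (Subtype.val : Config Z → Measure Z) from h.comap_le
  refine @Measure.measurable_of_measurable_coe _ _ _ m _ fun B hB => ?_
  have hB' : ∀ ω : Config Z, ω.1 B =
      ∑' n, ω.1 (B ∩ disjointed (spanningSets μ) n) := fun ω => by
    have hd : Pairwise fun i j => Disjoint (B ∩ disjointed (spanningSets μ) i)
        (B ∩ disjointed (spanningSets μ) j) := fun i j hij =>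
      ((disjoint_disjointed _) hij).mono Set.inter_subset_right Set.inter_subset_right
    rw [← measure_iUnion hd fun n =>
      hB.inter (MeasurableSet.disjointed (measurableSet_spanningSets μ) n), ← Set.inter_iUnion,
      iUnion_disjointed, iUnion_spanningSets, Set.inter_univ]
  simp_rw [hB']
  refine Measurable.tsum fun n => ?_
  have hn : MeasurableSet (B ∩ disjointed (spanningSets μ) n) ∧
      μ (B ∩ disjointed (spanningSets μ) n) < ∞ :=
    ⟨hB.inter (MeasurableSet.disjointed (measurableSet_spanningSets μ) n),
      (measure_mono (Set.inter_subset_right.trans (disjointed_subset _ _))).trans_lt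
        (measure_spanningSets_lt_top μ n)⟩
  exact (comap_measurable _).mono (le_iSup (fun A : {A : Set Z // MeasurableSet A ∧ μ A < ∞} =>
    MeasurableSpace.comap (fun ω : Config Z => ω.1 A.1) inferInstance) ⟨_, hn⟩) le_rfl

variable [IsProbabilityMeasure P]

/-- Mecke formula for events depending on finitely many disjoint sets. -/
lemma IsPoissonMeasure.withDensity_preimage (hP : IsPoissonMeasure μ P) {r : ℕ}
    {C : Fin r → Set Z} (hC : ∀ i, MeasurableSet (C i)) (hμC : ∀ i, μ (C i) < ∞)
    (hd : Pairwise fun i j => Disjoint (C i) (C j)) (s : Fin r) {S : Set (Fin r → ℝ≥0∞)}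
    (hS : MeasurableSet S) :
    (P.withDensity fun ω => ω.1 (C s)) ((fun ω i => ω.1 (C i)) ⁻¹' S) =
      (P.prod (μ.restrict (C s))) (addPoint ⁻¹' ((fun ω i => ω.1 (C i)) ⁻¹' S)) := by
  have : IsFiniteMeasure (μ.restrict (C s)) := ⟨by simpa using hμC s⟩
  have hm : ∀ i, Measurable fun ω : Config Z => ω.1 (C i) :=
    fun i => measurable_config_apply (hC i)
  have hm1 : Measurable fun (ω : Config Z) i => ω.1 (C i) := measurable_pi_lambda _ hm
  have hm2 : Measurable fun (ω : Config Z) i => ω.1 (C i) + if i = s then 1 else 0 :=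
    measurable_pi_lambda _ fun i => (hm i).add_const _
  have h := congrArg (· S) (hP.map_withDensity_apply hC hμC hd s)
  simp only [Measure.map_apply hm1 hS, Measure.smul_apply, smul_eq_mul,
    Measure.map_apply hm2 hS] at h
  rw [h, Measure.prod_apply_symm (measurable_addPoint (hm1 hS)),
    setLIntegral_congr_fun (g := fun _ => P ((fun (ω : Config Z) i =>
      ω.1 (C i) + if i = s then 1 else 0) ⁻¹' S)) (hC s) ?_, setLIntegral_const, mul_comm]
  intro z hz
  dsimp only
  congr 1
  ext ω
  simp only [Set.mem_preimage, addPoint_apply]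
  have : (fun i => ω.1 (C i) + Measure.dirac z (C i)) =
      fun i => ω.1 (C i) + if i = s then 1 else 0 := by
    funext i
    rw [Measure.dirac_apply' _ (hC i)]
    -- A point of `C s` lies in no other cell, so the increment does not depend on `z`.
    split_ifs with his
    · rw [his, Set.indicator_of_mem hz, Pi.one_apply]
    · rw [Set.indicator_of_notMem (Set.disjoint_right.1 (hd his) hz)]
  rw [this]

/-- Mecke formula. -/
theorem IsPoissonMeasure.mecke [SigmaFinite μ] (hP : IsPoissonMeasure μ P) {B : Set Z}
    (hB : MeasurableSet B) (hμB : μ B < ∞) :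
    (P.withDensity fun ω => ω.1 B) = (P.prod (μ.restrict B)).map addPoint := by
  classical
  have : IsFiniteMeasure (μ.restrict B) := ⟨by simpa using hμB⟩
  have hfin : IsFiniteMeasure (P.withDensity fun ω => ω.1 B) :=
    isFiniteMeasure_withDensity (by rw [hP.lintegral_apply hB hμB]; exact hμB.ne)
  let m : {A : Set Z // MeasurableSet A ∧ μ A < ∞} → MeasurableSpace (Config Z) := fun A =>
    MeasurableSpace.comap (fun ω : Config Z => ω.1 A.1) inferInstance
  -- Both measures have total mass `μ B`; it remains to compare them on events involving finitely
  -- many evaluations.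
  refine ext_of_generate_finite
    (piiUnionInter (fun A => {s | MeasurableSet[m A] s}) Set.univ) ?_
    (isPiSystem_piiUnionInter _ (fun A => @MeasurableSpace.isPiSystem_measurableSet _ (m A)) _) ?_ ?_
  · rw [generateFrom_piiUnionInter_measurableSet m]
    simpa [m] using measurableSpace_config_eq μ
  · rintro _ ⟨t, -, f, hf, rfl⟩
    choose! T hT hTf using hf
    -- `B` joins the family as `none`, so the cells split `B` too, and with it both the density `ω
    -- B` and the restriction of `μ`.
    obtain ⟨r, C, hC, hμC, hd, S, hS⟩ := exists_disjoint_refinement (μ := μ)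
      (A := fun o : Option t => o.elim B fun A => A.1.1)
      (by rintro (_ | A); exacts [hB, A.1.2.1]) (by rintro (_ | A); exacts [hμB, A.1.2.2])
    have hsum : ∀ (ν : Measure Z) (o : Option t),
        ν (o.elim B fun A => A.1.1) = ∑ s ∈ S o, ν (C s) := fun ν o => by
      rw [hS o, measure_biUnion_finset (fun s _ u _ hsu => hd hsu) fun s _ => hC s]
    have hBS : B = ⋃ s ∈ S none, C s := hS none
    let U : Set (Fin r → ℝ≥0∞) := ⋂ A : t, {x | ∑ s ∈ S (some A), x s ∈ T A}
    have hU : MeasurableSet U := MeasurableSet.iInter fun A =>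
      (Finset.measurable_sum _ fun s _ => measurable_pi_apply s) (hT A A.2)
    have hpre : (⋂ x ∈ t, f x) = (fun (ω : Config Z) i => ω.1 (C i)) ⁻¹' U := by
      ext ω
      rw [Set.mem_iInter₂, Set.mem_preimage, Set.mem_iInter]
      refine Iff.trans (forall₂_congr fun A hA => ?_)
        (Subtype.forall (q := fun A : t => ∑ s ∈ S (some A), ω.1 (C s) ∈ T A)).symm
      rw [← hTf A hA, Set.mem_preimage]
      exact Iff.of_eq (congrArg (· ∈ T A) (hsum ω.1 (some ⟨A, hA⟩)))
    have hm1 : Measurable fun (ω : Config Z) i => ω.1 (C i) :=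
      measurable_pi_lambda _ fun i => measurable_config_apply (hC i)
    rw [hpre, Measure.map_apply measurable_addPoint (hm1 hU)]
    have hl : (P.withDensity fun ω => ω.1 B) =
        ∑ s ∈ S none, P.withDensity fun ω => ω.1 (C s) := by
      ext N hN
      rw [Measure.finsetSum_apply, withDensity_apply _ hN]
      simp_rw [withDensity_apply _ hN]
      rw [← lintegral_finsetSum _ fun s _ => measurable_config_apply (hC s)]
      exact lintegral_congr fun ω => hsum ω.1 none
    have hr : μ.restrict B = ∑ s ∈ S none, μ.restrict (C s) := by
      ext N hN
      rw [Measure.finsetSum_apply, Measure.restrict_apply hN, hBS, Set.inter_iUnion₂,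
        measure_biUnion_finset (fun s _ u _ hsu => (hd hsu).mono Set.inter_subset_right
          Set.inter_subset_right) fun s _ => hN.inter (hC s)]
      exact Finset.sum_congr rfl fun s _ => (Measure.restrict_apply hN).symm
    rw [hl, Measure.finsetSum_apply,
      Finset.sum_congr rfl fun s _ => hP.withDensity_preimage hC hμC hd s hU,
      Measure.prod_apply_symm (measurable_addPoint (hm1 hU)), hr, lintegral_finsetSum_measure]
    refine Finset.sum_congr rfl fun s _ => ?_
    have : IsFiniteMeasure (μ.restrict (C s)) := ⟨by simpa using hμC s⟩
    rw [Measure.prod_apply_symm (measurable_addPoint (hm1 hU))]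
  · rw [Measure.map_apply measurable_addPoint .univ]
    simp [hP.lintegral_apply hB hμB, Measure.prod_apply]

/-- Adding a point is nonsingular. -/
theorem IsPoissonMeasure.quasiMeasurePreserving_addPoint [SigmaFinite μ]
    (hP : IsPoissonMeasure μ P) :
    Measure.QuasiMeasurePreserving addPoint (P.prod μ) P := by
  refine ⟨measurable_addPoint, Measure.AbsolutelyContinuous.mk fun N hN hPN => ?_⟩
  rw [Measure.map_apply measurable_addPoint hN, Measure.prod_apply_symm (measurable_addPoint hN)]
  have h : ∀ n, ∫⁻ z in spanningSets μ n, P ((fun ω => (ω, z)) ⁻¹' (addPoint ⁻¹' N)) ∂μ = 0 :=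
    fun n => by
      have hm := measurableSet_spanningSets μ n
      have hf := measure_spanningSets_lt_top μ n
      have : IsFiniteMeasure (μ.restrict (spanningSets μ n)) := ⟨by simpa using hf⟩
      rw [← Measure.prod_apply_symm (measurable_addPoint hN),
        ← Measure.map_apply measurable_addPoint hN, ← hP.mecke hm hf]
      -- By Mecke, the image of `P ⊗ μ` restricted to a set of finite measure has a density with
      -- respect to `P`.
      exact withDensity_absolutelyContinuous _ _ hPN
  rw [← setLIntegral_univ, ← iUnion_spanningSets μ]
  exact le_antisymm ((lintegral_iUnion_le _ _).trans (by simp [h])) zero_le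

end PoissonSpace

/-! ### Moments and add-one cost of elementary multiple integrals. -/

namespace PoissonSpace

variable {Z : Type*} [MeasurableSpace Z] {μ : Measure Z} {P : Measure (Config Z)}

lemma memLp_finsetProd {Ω ι : Type*} [MeasurableSpace Ω] {Q : Measure Ω} [IsProbabilityMeasure Q]
    {f : ι → Ω → ℝ} (s : Finset ι) (hf : ∀ i ∈ s, ∀ p : ℝ≥0∞, p ≠ ∞ → MemLp (f i) p Q)
    {p : ℝ≥0∞} (hp : p ≠ ∞) : MemLp (fun ω => ∏ i ∈ s, f i ω) p Q := by
  induction s using Finset.cons_induction generalizing p with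
  | empty => simpa using memLp_const 1
  | cons i s hi ih =>
    simp only [Finset.prod_cons]
    have h2 : 2 * p ≠ ∞ := ENNReal.mul_ne_top (by simp) hp
    refine (ih (fun j hj => hf j (Finset.mem_cons_of_mem hj)) h2).mul'
      (hf i (Finset.mem_cons_self _ _) _ h2) (hpqr := ⟨?_⟩)
    rw [ENNReal.mul_inv (by simp) (by simp), ← add_mul, ENNReal.inv_two_add_inv_two, one_mul]

lemma measurable_compensated {B : Set Z} (hB : MeasurableSet B) :
    Measurable (compensated μ B) :=
  ((measurable_config_apply hB).ennreal_toReal).sub_const _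

/-- Each size-biasing lowers the power by one but shifts the argument by one, so the induction runs
over all `c` at once. -/
lemma IsPoissonMeasure.lintegral_add_pow_lt_top [IsProbabilityMeasure P]
    (hP : IsPoissonMeasure μ P) {B : Set Z} (hB : MeasurableSet B) (hμB : μ B < ∞) (n c : ℕ) :
    ∫⁻ ω, (ω.1 B + c) ^ n ∂P < ∞ := by
  have hm := measurable_config_apply hB
  induction n generalizing c with
  | zero => simp
  | succ n ih =>
    have h : ∀ ω : Config Z, (ω.1 B + c) ^ (n + 1) =
        ω.1 B * (ω.1 B + c) ^ n + c * (ω.1 B + c) ^ n := fun ω => by ring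
    simp_rw [h]
    rw [lintegral_add_left (by fun_prop), lintegral_const_mul _ (by fun_prop),
      hP.lintegral_apply_mul_comp hB hμB (h := fun x => (x + c) ^ n) (by fun_prop)]
    have h1 := ih (1 + c)
    simp only [Nat.cast_add, Nat.cast_one, ← add_assoc] at h1
    exact ENNReal.add_lt_top.2 ⟨ENNReal.mul_lt_top hμB h1,
      ENNReal.mul_lt_top (ENNReal.natCast_lt_top c) (ih c)⟩

lemma IsPoissonMeasure.memLp_compensated [IsProbabilityMeasure P]
    (hP : IsPoissonMeasure μ P) {B : Set Z} (hB : MeasurableSet B) (hμB : μ B < ∞)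
    {p : ℝ≥0∞} (hp : p ≠ ∞) : MemLp (compensated μ B) p P := by
  obtain ⟨n, hn⟩ := ENNReal.exists_nat_gt hp
  have hn0 : n ≠ 0 := by rintro rfl; simp at hn
  have hm : AEStronglyMeasurable (fun ω : Config Z => (ω.1 B).toReal) P :=
    (measurable_config_apply hB).ennreal_toReal.aestronglyMeasurable
  have : MemLp (fun ω : Config Z => (ω.1 B).toReal) n P := by
    refine ⟨hm, ?_⟩
    rw [eLpNorm_lt_top_iff_lintegral_rpow_enorm_lt_top (by simpa using hn0) (by simp)]
    refine lt_of_le_of_lt (lintegral_mono fun ω => ?_)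
      (hP.lintegral_add_pow_lt_top hB hμB n 0)
    simp only [ENNReal.toReal_natCast, ENNReal.rpow_natCast, Nat.cast_zero, add_zero]
    gcongr
    rw [← ofReal_norm, Real.norm_of_nonneg ENNReal.toReal_nonneg]
    exact ENNReal.ofReal_toReal_le
  exact (this.mono_exponent hn.le).sub (memLp_const (μ.real B))

/-- The integrand in the remaining variables when the `j`-th variable equals `z`. -/
noncomputable def Elementary.slice {k : ℕ} (g : Elementary μ (k + 1)) (j : Fin (k + 1)) (z : Z) :
    Elementary μ k where
  card := g.card
  -- Terms whose side misses `z` remain, with coefficient zero, so that `card` does not vary with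
  -- `z`.
  coeff i := g.coeff i * (g.side i j).indicator (fun _ => 1) z
  side i l := g.side i (j.succAbove l)
  measurableSet_side i _ := g.measurableSet_side i _
  side_lt_top i _ := g.side_lt_top i _
  disjoint_side i _ _ h := g.disjoint_side i (Fin.succAbove_right_injective.ne h)

lemma Elementary.slice_toFun {k : ℕ} (g : Elementary μ (k + 1)) (j : Fin (k + 1)) (z : Z)
    (y : Fin k → Z) :
    (g.slice j z).toFun y = g.toFun (j.insertNth (α := fun _ => Z) z y) := by
  simp only [toFun, slice]
  refine Finset.sum_congr rfl fun i _ => ?_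
  rw [Fin.prod_univ_succAbove _ j, mul_assoc]
  simp

lemma Elementary.slice_integral {k : ℕ} (g : Elementary μ (k + 1)) (j : Fin (k + 1)) (z : Z)
    (ω : Config Z) : (g.slice j z).integral ω =
      ∑ i, g.coeff i * (g.side i j).indicator (fun _ => 1) z *
        ∏ l, compensated μ (g.side i (j.succAbove l)) ω := rfl

/-- Difference of two elementary integrands. -/
noncomputable def Elementary.sub {k : ℕ} (g h : Elementary μ k) : Elementary μ k where
  card := g.card + h.card
  coeff := Fin.append g.coeff fun i => -h.coeff i
  side := Fin.append g.side h.side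
  measurableSet_side i j := by
    refine Fin.addCases (fun i => ?_) (fun i => ?_) i
    · simpa using g.measurableSet_side i j
    · simpa using h.measurableSet_side i j
  side_lt_top i j := by
    refine Fin.addCases (fun i => ?_) (fun i => ?_) i
    · simpa using g.side_lt_top i j
    · simpa using h.side_lt_top i j
  disjoint_side i := by
    refine Fin.addCases (fun i => ?_) (fun i => ?_) i
    · simpa using g.disjoint_side i
    · simpa using h.disjoint_side i

lemma Elementary.sub_toFun {k : ℕ} (g h : Elementary μ k) (x : Fin k → Z) :
    (g.sub h).toFun x = g.toFun x - h.toFun x := by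
  exact (Fin.sum_univ_add _).trans (by simp [toFun, sub, sub_eq_add_neg])

lemma Elementary.sub_integral {k : ℕ} (g h : Elementary μ k) (ω : Config Z) :
    (g.sub h).integral ω = g.integral ω - h.integral ω := by
  exact (Fin.sum_univ_add _).trans (by simp [integral, sub, sub_eq_add_neg])

lemma Elementary.measurable_integral {k : ℕ} (g : Elementary μ k) : Measurable g.integral :=
  Finset.measurable_sum _ fun i _ => (Finset.measurable_prod _ fun j _ =>
    measurable_compensated (g.measurableSet_side i j)).const_mul _

lemma Elementary.measurable_toFun {k : ℕ} (g : Elementary μ k) : Measurable g.toFun :=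
  Finset.measurable_sum _ fun i _ => (Finset.measurable_prod _ fun j _ =>
    (measurable_const.indicator (g.measurableSet_side i j)).comp
      (measurable_pi_apply j)).const_mul _

lemma Elementary.memLp_toFun [SigmaFinite μ] {k : ℕ} (g : Elementary μ k) (p : ℝ≥0∞) :
    MemLp g.toFun p (powMeasure μ k) := by
  refine memLp_finsetSum _ fun i _ => MemLp.const_mul ?_ _
  simp_rw [prod_indicator_one]
  refine memLp_indicator_const p (MeasurableSet.univ_pi (g.measurableSet_side i)) 1 (Or.inr ?_)
  rw [Measure.pi_pi]
  exact ENNReal.prod_ne_top fun j _ => (g.side_lt_top i j).ne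

lemma IsPoissonMeasure.memLp_integral [IsProbabilityMeasure P] (hP : IsPoissonMeasure μ P)
    {k : ℕ} (g : Elementary μ k) {p : ℝ≥0∞} (hp : p ≠ ∞) : MemLp g.integral p P :=
  memLp_finsetSum _ fun i _ => MemLp.const_mul (memLp_finsetProd _ (fun j _ _ hq =>
    hP.memLp_compensated (g.measurableSet_side i j) (g.side_lt_top i j) hq) hp) _

lemma IsPoissonMeasure.ae_side_lt_top (hP : IsPoissonMeasure μ P) {k : ℕ} (g : Elementary μ k) :
    ∀ᵐ ω ∂P, ∀ i j, ω.1 (g.side i j) < ∞ :=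
  ae_all_iff.2 fun i => ae_all_iff.2 fun j =>
    hP.ae_lt_top (g.measurableSet_side i j) (g.side_lt_top i j)

lemma compensated_addPoint {B : Set Z} (hB : MeasurableSet B) {ω : Config Z} (hω : ω.1 B < ∞)
    (z : Z) :
    compensated μ B (addPoint (ω, z)) = compensated μ B ω + B.indicator (fun _ => 1) z := by
  have h : Measure.dirac z B ≠ ∞ := measure_ne_top _ _
  simp only [compensated, measureReal_def]
  rw [addPoint_apply, ENNReal.toReal_add hω.ne h, Measure.dirac_apply' _ hB]
  by_cases hz : z ∈ B
  · simp only [hz, Set.indicator_of_mem, Pi.one_apply, ENNReal.toReal_one]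
    ring
  · simp [hz]

/-- At most one indicator is nonzero at `z`, so the expansion has no terms beyond first order. This
is where off-diagonal integrands matter. -/
lemma prod_add_indicator {α : Type*} {k : ℕ} {A : Fin (k + 1) → Set α}
    (hA : Pairwise fun i j => Disjoint (A i) (A j)) (c : Fin (k + 1) → ℝ) (z : α) :
    ∏ j, (c j + (A j).indicator (fun _ => 1) z) =
      ∏ j, c j + ∑ j, (A j).indicator (fun _ => 1) z * ∏ l, c (j.succAbove l) := by
  by_cases h : ∃ j, z ∈ A j
  · obtain ⟨j, hj⟩ := h
    have hl : ∀ l, l ≠ j → z ∉ A l := fun l hlj => Set.disjoint_right.1 (hA hlj) hj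
    rw [Finset.sum_eq_single j (fun l _ hlj => by simp [hl l hlj]) (by simp),
      Fin.prod_univ_succAbove _ j, Fin.prod_univ_succAbove c j]
    simp only [Set.indicator_of_mem hj, Set.indicator_of_notMem (hl _ (Fin.succAbove_ne _ _))]
    simp only [add_zero]
    ring
  · push Not at h
    simp [h]

/-- The add-one cost of an elementary multiple integral. -/
lemma Elementary.integral_addPoint {k : ℕ} (g : Elementary μ (k + 1)) {ω : Config Z}
    (hω : ∀ i j, ω.1 (g.side i j) < ∞) (z : Z) :
    g.integral (addPoint (ω, z)) = g.integral ω + ∑ j, (g.slice j z).integral ω := by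
  simp only [slice_integral]
  rw [Finset.sum_comm, integral, integral, ← Finset.sum_add_distrib]
  refine Finset.sum_congr rfl fun i _ => ?_
  rw [Finset.prod_congr rfl fun j _ => compensated_addPoint (g.measurableSet_side i j) (hω i j) z,
    prod_add_indicator (g.disjoint_side i), mul_add, Finset.mul_sum]
  simp only [mul_assoc]

end PoissonSpace

/-! ### Integration by parts and the `L²` bound for elementary integrals. -/

namespace PoissonSpace

variable {Z : Type*} [MeasurableSpace Z] {μ : Measure Z} {P : Measure (Config Z)}

/-- Integration by parts against the compensated measure of a set. -/
lemma IsPoissonMeasure.integral_compensated_mul [IsProbabilityMeasure P] [SigmaFinite μ]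
    (hP : IsPoissonMeasure μ P) {A : Set Z} (hA : MeasurableSet A) (hμA : μ A < ∞)
    {H : Config Z → ℝ} (hHm : Measurable H) (hH : MemLp H 2 P) :
    IntegrableOn (fun z => ∫ ω, H (addPoint (ω, z)) ∂P - ∫ ω, H ω ∂P) A μ ∧
      ∫ ω, compensated μ A ω * H ω ∂P =
        ∫ z in A, (∫ ω, H (addPoint (ω, z)) ∂P - ∫ ω, H ω ∂P) ∂μ := by
  have : IsFiniteMeasure (μ.restrict A) := ⟨by simpa using hμA⟩
  have hm := measurable_config_apply hA
  have hH1 : Integrable H P := hH.integrable (by norm_num)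
  have hcH : Integrable (fun ω => compensated μ A ω * H ω) P :=
    (hP.memLp_compensated hA hμA (p := 2) (by simp)).integrable_mul hH
  have htH : Integrable (fun ω : Config Z => (ω.1 A).toReal * H ω) P := by
    refine (hcH.add (hH1.const_mul (μ.real A))).congr (ae_of_all _ fun ω => ?_)
    simp only [Pi.add_apply, compensated, measureReal_def]
    ring
  have hwd : Integrable H (P.withDensity fun ω => ω.1 A) := by
    rw [integrable_withDensity_iff_integrable_smul' hm (hP.ae_lt_top hA hμA)]
    simpa using htH
  have hmap := hwd
  rw [hP.mecke hA hμA, integrable_map_measure hHm.aestronglyMeasurable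
    measurable_addPoint.aemeasurable] at hmap
  replace hmap : Integrable (fun p => H (addPoint p)) (P.prod (μ.restrict A)) := hmap
  have hint : ∫ ω, (ω.1 A).toReal * H ω ∂P = ∫ z in A, ∫ ω, H (addPoint (ω, z)) ∂P ∂μ := by
    rw [← integral_prod_symm (fun p => H (addPoint p)) hmap, ← integral_map measurable_addPoint.aemeasurable
      hHm.aestronglyMeasurable, ← hP.mecke hA hμA,
      integral_withDensity_eq_integral_toReal_smul hm (hP.ae_lt_top hA hμA)]
    simp
  refine ⟨hmap.integral_prod_right.sub (integrable_const _), ?_⟩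
  rw [integral_sub hmap.integral_prod_right (integrable_const _)]
  rw [← hint, setIntegral_const, smul_eq_mul, ← integral_const_mul,
    ← integral_sub htH (hH1.const_mul _)]
  refine integral_congr_ae (ae_of_all _ fun ω => ?_)
  simp only [compensated, measureReal_def]
  ring

lemma measurePreserving_insertNth (μ : Measure Z) [SigmaFinite μ] {k : ℕ} (j : Fin (k + 1)) :
    MeasurePreserving (fun p : Z × (Fin k → Z) => j.insertNth (α := fun _ => Z) p.1 p.2)
      (μ.prod (powMeasure μ k)) (powMeasure μ (k + 1)) :=
  (measurePreserving_piFinSuccAbove (fun _ : Fin (k + 1) => μ) j).symm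

lemma Elementary.integrable_slice_sq [SigmaFinite μ] {k : ℕ} (g : Elementary μ (k + 1))
    (j : Fin (k + 1)) :
    Integrable (fun z => ∫ y, (g.slice j z).toFun y ^ 2 ∂powMeasure μ k) μ ∧
      ∫ z, ∫ y, (g.slice j z).toFun y ^ 2 ∂powMeasure μ k ∂μ =
        ∫ x, g.toFun x ^ 2 ∂powMeasure μ (k + 1) := by
  have hmp := measurePreserving_insertNth μ j
  have hm : Measurable fun x => g.toFun x ^ 2 := g.measurable_toFun.pow_const 2
  have hi : Integrable (fun x => g.toFun x ^ 2) (powMeasure μ (k + 1)) :=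
    (g.memLp_toFun 2).integrable_sq
  have hi' := hmp.integrable_comp_of_integrable hi
  simp only [slice_toFun]
  refine ⟨hi'.integral_prod_left, ?_⟩
  rw [← hmp.map_eq, integral_map hmp.measurable.aemeasurable hm.aestronglyMeasurable]
  exact (integral_prod _ hi').symm

/-- Elementary multiple integrals are bounded in `L²`. -/
theorem IsPoissonMeasure.integral_sq_le [IsProbabilityMeasure P] [SigmaFinite μ]
    (hP : IsPoissonMeasure μ P) {k : ℕ} (g : Elementary μ k) :
    ∫ ω, g.integral ω ^ 2 ∂P ≤ k.factorial * ∫ x, g.toFun x ^ 2 ∂powMeasure μ k := by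
  induction k with
  | zero =>
    simp [Elementary.integral, Elementary.toFun, measureReal_def]
  | succ k ih =>
    let K : Fin g.card → Config Z → ℝ := fun i ω => ∏ l : Fin k, compensated μ (g.side i l.succ) ω
    let D : Z → Config Z → ℝ := fun z ω => ∑ j, (g.slice j z).integral ω
    have hKm : ∀ i, Measurable (K i) := fun i => Finset.measurable_prod _ fun l _ =>
      measurable_compensated (g.measurableSet_side i l.succ)
    have hK : ∀ i {p : ℝ≥0∞}, p ≠ ∞ → MemLp (K i) p P := fun i p hp =>
      memLp_finsetProd _ (fun l _ _ hq =>
        hP.memLp_compensated (g.measurableSet_side i _) (g.side_lt_top i _) hq) hp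
    have hD : ∀ z {p : ℝ≥0∞}, p ≠ ∞ → MemLp (D z) p P := fun z p hp =>
      memLp_finsetSum _ fun j _ => hP.memLp_integral (g.slice j z) hp
    have hKg : ∀ i, MemLp (fun ω => K i ω * g.integral ω) 2 P := fun i =>
      (hP.memLp_integral g (p := 4) (by simp)).mul' (hK i (p := 4) (by simp)) (hpqr := ⟨by
        rw [show (4 : ℝ≥0∞) = 2 * 2 by norm_num, ENNReal.mul_inv (by simp) (by simp), ← add_mul,
          ENNReal.inv_two_add_inv_two, one_mul]⟩)
    have hKD : ∀ i z, Integrable (fun ω => K i ω * D z ω) P := fun i z =>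
      (hK i (p := 2) (by simp)).integrable_mul (hD z (p := 2) (by simp))
    -- A point in the first side lies outside the other sides: `K i` is unchanged and only the
    -- factor `g.integral` gains `D z`.
    have hdiff : ∀ i, ∀ z ∈ g.side i 0,
        ∫ ω, K i (addPoint (ω, z)) * g.integral (addPoint (ω, z)) ∂P -
          ∫ ω, K i ω * g.integral ω ∂P = ∫ ω, K i ω * D z ω ∂P := fun i z hz => by
      rw [sub_eq_iff_eq_add', ← integral_add ((hKg i).integrable (by norm_num)) (hKD i z)]
      refine integral_congr_ae ?_
      filter_upwards [hP.ae_side_lt_top g] with ω hω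
      rw [g.integral_addPoint hω, ← mul_add]
      congr 1
      refine Finset.prod_congr rfl fun l _ => ?_
      rw [compensated_addPoint (g.measurableSet_side i _) (hω i _), Set.indicator_of_notMem,
        add_zero]
      exact Set.disjoint_right.1 (g.disjoint_side i (Fin.succ_ne_zero l)) hz
    have hibp := fun i => hP.integral_compensated_mul (g.measurableSet_side i 0)
      (g.side_lt_top i 0) ((hKm i).mul g.measurable_integral) (hKg i)
    have hint : ∀ i, IntegrableOn (fun z => ∫ ω, K i ω * D z ω ∂P) (g.side i 0) μ := fun i =>
      (hibp i).1.congr_fun (hdiff i) (g.measurableSet_side i 0)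
    have hibp' : ∀ i, ∫ ω, compensated μ (g.side i 0) ω * (K i ω * g.integral ω) ∂P =
        ∫ z in g.side i 0, ∫ ω, K i ω * D z ω ∂P ∂μ := fun i =>
      (hibp i).2.trans (setIntegral_congr_fun (g.measurableSet_side i 0) (hdiff i))
    have hcK : ∀ i, Integrable (fun ω => compensated μ (g.side i 0) ω * (K i ω * g.integral ω)) P :=
      fun i => (hP.memLp_compensated (g.measurableSet_side i 0) (g.side_lt_top i 0)
        (p := 2) (by simp)).integrable_mul (hKg i)
    have hslice : ∀ z, ∑ i, g.coeff i * (g.side i 0).indicator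
        (fun z => ∫ ω, K i ω * D z ω ∂P) z = ∫ ω, (g.slice 0 z).integral ω * D z ω ∂P := fun z => by
      simp only [Elementary.slice_integral, Finset.sum_mul, Fin.zero_succAbove]
      rw [integral_finsetSum _ fun i _ => ?_]
      · refine Finset.sum_congr rfl fun i _ => ?_
        simp only [mul_assoc, integral_const_mul]
        congr 1
        by_cases hz : z ∈ g.side i 0 <;> simp [hz, K]
      · simp only [mul_assoc]
        exact ((hKD i z).const_mul _).const_mul _
    -- Integration by parts in the first variable: `E[I(g)²] = ∫ E[I(g(z,·)) D_z I(g)] μ(dz)`.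
    have hmain : ∫ ω, g.integral ω ^ 2 ∂P = ∫ z, ∫ ω, (g.slice 0 z).integral ω * D z ω ∂P ∂μ := by
      have h1 : ∀ ω, g.integral ω ^ 2 = ∑ i, g.coeff i *
          (compensated μ (g.side i 0) ω * (K i ω * g.integral ω)) := fun ω => by
        rw [sq]
        nth_rw 1 [Elementary.integral]
        rw [Finset.sum_mul]
        refine Finset.sum_congr rfl fun i _ => ?_
        rw [Fin.prod_univ_succ]
        ring
      simp_rw [h1, ← hslice]
      rw [integral_finsetSum _ fun i _ => (hcK i).const_mul _, integral_finsetSum _ fun i _ =>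
        ((integrable_indicator_iff (g.measurableSet_side i 0)).2 (hint i)).const_mul _]
      refine Finset.sum_congr rfl fun i _ => ?_
      rw [integral_const_mul, integral_const_mul, integral_indicator (g.measurableSet_side i 0),
        hibp' i]
    have hint' : Integrable (fun z => ∫ ω, (g.slice 0 z).integral ω * D z ω ∂P) μ := by
      simp_rw [← hslice]
      exact integrable_finsetSum _ fun i _ =>
        ((integrable_indicator_iff (g.measurableSet_side i 0)).2 (hint i)).const_mul _
    let N : Fin (k + 1) → Z → ℝ := fun j z => ∫ y, (g.slice j z).toFun y ^ 2 ∂powMeasure μ k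
    have hN := fun j => g.integrable_slice_sq j
    -- From `ab ≤ (a² + b²)/2` and the induction hypothesis. All slices have the same total norm
    -- `‖g‖²`, so each of the `k + 1` indices contributes `k! ‖g‖²` after integration; no
    -- symmetrisation of `g` is needed.
    have hle : ∀ z, ∫ ω, (g.slice 0 z).integral ω * D z ω ∂P ≤
        ∑ j, (k.factorial : ℝ) / 2 * (N 0 z + N j z) := fun z => by
      have hI : ∀ j, MemLp (g.slice j z).integral 2 P := fun j =>
        hP.memLp_integral (g.slice j z) (by simp)
      have hII : ∀ j, Integrable (fun ω => (g.slice 0 z).integral ω * (g.slice j z).integral ω) P :=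
        fun j => (hI 0).integrable_mul (hI j)
      simp only [D, Finset.mul_sum]
      rw [integral_finsetSum _ fun j _ => hII j]
      refine Finset.sum_le_sum fun j _ => ?_
      calc ∫ ω, (g.slice 0 z).integral ω * (g.slice j z).integral ω ∂P
          ≤ ∫ ω, ((g.slice 0 z).integral ω ^ 2 + (g.slice j z).integral ω ^ 2) / 2 ∂P := by
            refine integral_mono (hII j)
              (((hI 0).integrable_sq.add (hI j).integrable_sq).div_const 2) fun ω => ?_
            have := two_mul_le_add_sq ((g.slice 0 z).integral ω) ((g.slice j z).integral ω)
            dsimp only [Pi.mul_apply]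
            linarith
        _ ≤ (k.factorial : ℝ) / 2 * (N 0 z + N j z) := by
            rw [integral_div, integral_add (hI 0).integrable_sq (hI j).integrable_sq]
            have h0 := ih (g.slice 0 z)
            have hj := ih (g.slice j z)
            simp only [N]
            linarith
    have hNi : ∀ j, Integrable (fun z => (k.factorial : ℝ) / 2 * (N 0 z + N j z)) μ := fun j =>
      ((hN 0).1.add (hN j).1).const_mul _
    rw [hmain]
    refine (integral_mono hint' (integrable_finsetSum _ fun j _ => hNi j) hle).trans_eq ?_
    rw [integral_finsetSum _ fun j _ => hNi j]
    have : ∀ j, ∫ z, (k.factorial : ℝ) / 2 * (N 0 z + N j z) ∂μ =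
        k.factorial * ∫ x, g.toFun x ^ 2 ∂powMeasure μ (k + 1) := fun j => by
      rw [integral_const_mul, integral_add (hN 0).1 (hN j).1, (hN 0).2, (hN j).2]
      ring
    simp only [this, Finset.sum_const, Finset.card_univ, Fintype.card_fin, nsmul_eq_mul,
      Nat.factorial_succ]
    push_cast
    ring

end PoissonSpace

/-! ### Passage to the limit: the Malliavin derivative as add-one cost. -/

namespace PoissonSpace

/-- Along a subsequence the integrals are summable, hence the functions are almost everywhere
summable. -/
lemma exists_subseq_ae_tendsto_zero {α : Type*} [MeasurableSpace α] {ν : Measure α}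
    {Ψ : ℕ → α → ℝ≥0∞} (hm : ∀ n, AEMeasurable (Ψ n) ν)
    (h : Tendsto (fun n => ∫⁻ a, Ψ n a ∂ν) atTop (𝓝 0)) :
    ∃ φ : ℕ → ℕ, StrictMono φ ∧ ∀ᵐ a ∂ν, Tendsto (fun n => Ψ (φ n) a) atTop (𝓝 0) := by
  obtain ⟨ε, hε, hεs⟩ := ENNReal.exists_pos_sum_of_countable' one_ne_zero ℕ
  obtain ⟨φ, hφ, hle⟩ := extraction_forall_of_eventually fun n =>
    (h.eventually (gt_mem_nhds (hε n)))
  refine ⟨φ, hφ, ?_⟩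
  have hfin : ∫⁻ a, ∑' n, Ψ (φ n) a ∂ν ≠ ∞ := by
    rw [lintegral_tsum fun n => hm _]
    exact ((ENNReal.tsum_le_tsum fun n => (hle n).le).trans_lt
      (hεs.trans ENNReal.one_lt_top)).ne
  filter_upwards [ae_lt_top' (AEMeasurable.tsum fun n => hm (φ n)) hfin] with a ha
  exact ENNReal.tendsto_atTop_zero_of_tsum_ne_top ha.ne

section Prod

variable {α β : Type*} [MeasurableSpace α] [MeasurableSpace β] {μ : Measure α} {ν : Measure β}
  [SFinite μ] [SFinite ν]

lemma ae_ae_swap_of_ae_prod {p : α × β → Prop} (h : ∀ᵐ x ∂μ.prod ν, p x) :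
    ∀ᵐ b ∂ν, ∀ᵐ a ∂μ, p (a, b) :=
  Measure.ae_ae_of_ae_prod (p := fun x : β × α => p x.swap)
    (Measure.measurePreserving_swap.quasiMeasurePreserving.ae h)

/-- The kernel identities hold for almost every fixed `z`. Measurable representatives make the
equality set measurable, so Fubini applies. -/
lemma ae_eq_prod_of_ae_ae_swap {X Y : α × β → ℝ} (hX : AEStronglyMeasurable X (μ.prod ν))
    (hY : AEStronglyMeasurable Y (μ.prod ν)) (h : ∀ᵐ b ∂ν, ∀ᵐ a ∂μ, X (a, b) = Y (a, b)) :
    X =ᵐ[μ.prod ν] Y := by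
  obtain ⟨X', hX', hXX⟩ := hX
  obtain ⟨Y', hY', hYY⟩ := hY
  have hms : MeasurableSet {x : α × β | X' x = Y' x} :=
    measurableSet_eq_fun hX'.measurable hY'.measurable
  have : X' =ᵐ[μ.prod ν] Y' := by
    refine (Measure.ae_prod_iff_ae_ae hms).2 ((Measure.ae_ae_comm hms).2 ?_)
    filter_upwards [h, ae_ae_swap_of_ae_prod hXX, ae_ae_swap_of_ae_prod hYY] with b h1 h2 h3
    filter_upwards [h1, h2, h3] with a h1 h2 h3
    exact h2.symm.trans (h1.trans h3)
  exact hXX.trans (this.trans hYY.symm)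

end Prod

lemma eLpNorm_two_eq_sqrt {α : Type*} [MeasurableSpace α] {ν : Measure α} {f : α → ℝ}
    (hf : MemLp f 2 ν) : eLpNorm f 2 ν = ENNReal.ofReal √(∫ a, f a ^ 2 ∂ν) := by
  rw [hf.eLpNorm_eq_integral_rpow_norm (by simp) (by simp), Real.sqrt_eq_rpow]
  simp

variable {Z : Type*} [MeasurableSpace Z] {μ : Measure Z} {P : Measure (Config Z)}

lemma IsPoissonMeasure.eLpNorm_integral_sub_le [IsProbabilityMeasure P] [SigmaFinite μ]
    (hP : IsPoissonMeasure μ P) {k : ℕ} (g h : Elementary μ k) :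
    eLpNorm (fun ω => g.integral ω - h.integral ω) 2 P ≤
      ENNReal.ofReal √k.factorial *
        eLpNorm (fun x => g.toFun x - h.toFun x) 2 (powMeasure μ k) := by
  simp_rw [← Elementary.sub_integral, ← Elementary.sub_toFun]
  rw [eLpNorm_two_eq_sqrt (hP.memLp_integral (g.sub h) (by simp)),
    eLpNorm_two_eq_sqrt ((g.sub h).memLp_toFun 2), ← ENNReal.ofReal_mul (Real.sqrt_nonneg _),
    ← Real.sqrt_mul (Nat.cast_nonneg _)]
  exact ENNReal.ofReal_le_ofReal (Real.sqrt_le_sqrt (hP.integral_sq_le _))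

/-- The multiple integral does not depend on the approximating sequence. -/
lemma IsMultipleIntegral.tendsto_integral [IsProbabilityMeasure P] [SigmaFinite μ]
    (hP : IsPoissonMeasure μ P) {k : ℕ} {f : (Fin k → Z) → ℝ} {X : Config Z → ℝ}
    (hX : IsMultipleIntegral μ P k f X) {h : ℕ → Elementary μ k}
    (hh : Tendsto (fun n => eLpNorm (fun x => (h n).toFun x - f x) 2 (powMeasure μ k))
      atTop (𝓝 0)) :
    Tendsto (fun n => eLpNorm (fun ω => (h n).integral ω - X ω) 2 P) atTop (𝓝 0) := by
  obtain ⟨g, hgf, hgX⟩ := hX.exists_approx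
  have hlim : Tendsto (fun n => ENNReal.ofReal √k.factorial *
      (eLpNorm (fun x => (h n).toFun x - f x) 2 (powMeasure μ k) +
        eLpNorm (fun x => (g n).toFun x - f x) 2 (powMeasure μ k)) +
      eLpNorm (fun ω => (g n).integral ω - X ω) 2 P) atTop (𝓝 0) := by
    simpa using (ENNReal.Tendsto.const_mul (hh.add hgf)
      (Or.inr ENNReal.ofReal_ne_top)).add hgX
  refine tendsto_of_tendsto_of_tendsto_of_le_of_le tendsto_const_nhds hlim
    (fun n => zero_le) fun n => ?_
  have hm1 : ∀ g : Elementary μ k, AEStronglyMeasurable (fun x => g.toFun x - f x)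
      (powMeasure μ k) := fun g =>
    g.measurable_toFun.aestronglyMeasurable.sub hX.memLp_kernel.aestronglyMeasurable
  have e1 : (fun ω => (h n).integral ω - X ω) =
      (fun ω => (h n).integral ω - (g n).integral ω) + fun ω => (g n).integral ω - X ω := by
    ext; simp
  have e2 : (fun x => (h n).toFun x - (g n).toFun x) =
      (fun x => (h n).toFun x - f x) - fun x => (g n).toFun x - f x := by
    ext; simp
  dsimp only
  rw [e1]
  refine (eLpNorm_add_le ((h n).measurable_integral.sub
    (g n).measurable_integral).aestronglyMeasurable
    ((g n).measurable_integral.aestronglyMeasurable.sub hX.memLp.aestronglyMeasurable)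
    (by norm_num)).trans (add_le_add_left ((hP.eLpNorm_integral_sub_le _ _).trans ?_) _)
  rw [e2]
  gcongr
  exact eLpNorm_sub_le (hm1 _) (hm1 _) (by norm_num)

/-- Symmetry under this permutation makes all `k + 1` slices of a symmetric kernel agree. -/
lemma cons_comp_cycleRange {α : Type*} {k : ℕ} (j : Fin (k + 1)) (z : α) (y : Fin k → α) :
    (Fin.cons z y : Fin (k + 1) → α) ∘ j.cycleRange = j.insertNth (α := fun _ => α) z y := by
  ext i
  refine Fin.succAboveCases j ?_ (fun l => ?_) i
  · simp
  · simp

lemma eLpNorm_two_sq {α : Type*} [MeasurableSpace α] (ν : Measure α) (f : α → ℝ) :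
    eLpNorm f 2 ν ^ 2 = ∫⁻ a, ‖f a‖ₑ ^ 2 ∂ν := by
  simpa using eLpNorm_nnreal_pow_eq_lintegral (p := 2) (f := f) (μ := ν) (by norm_num)

/-- Slices of an `L²`-convergent sequence converge along a subsequence. -/
lemma exists_subseq_slice_tendsto [SigmaFinite μ] {k : ℕ} {f : (Fin (k + 1) → Z) → ℝ}
    (hf : IsSymmKernel μ (k + 1) f) {g : ℕ → Elementary μ (k + 1)}
    (hg : Tendsto (fun n => eLpNorm (fun x => (g n).toFun x - f x) 2 (powMeasure μ (k + 1)))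
      atTop (𝓝 0)) :
    ∃ φ : ℕ → ℕ, StrictMono φ ∧ ∀ᵐ z ∂μ, ∀ j, Tendsto (fun n => eLpNorm (fun y =>
      ((g (φ n)).slice j z).toFun y - f (Fin.cons z y)) 2 (powMeasure μ k)) atTop (𝓝 0) := by
  let w : ℕ → Fin (k + 1) → Z × (Fin k → Z) → ℝ≥0∞ := fun n j p =>
    ‖(g n).toFun (j.insertNth (α := fun _ => Z) p.1 p.2) -
      f (j.insertNth (α := fun _ => Z) p.1 p.2)‖ₑ ^ 2
  have hm : ∀ n, AEMeasurable (fun x => ‖(g n).toFun x - f x‖ₑ ^ 2) (powMeasure μ (k + 1)) :=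
    fun n => ((g n).measurable_toFun.aemeasurable.sub
      hf.1.aestronglyMeasurable.aemeasurable).enorm.pow_const 2
  have hw : ∀ n j, AEMeasurable (w n j) (μ.prod (powMeasure μ k)) := fun n j =>
    (hm n).comp_quasiMeasurePreserving (measurePreserving_insertNth μ j).quasiMeasurePreserving
  have hint : ∀ n j, ∫⁻ z, ∫⁻ y, w n j (z, y) ∂powMeasure μ k ∂μ =
      eLpNorm (fun x => (g n).toFun x - f x) 2 (powMeasure μ (k + 1)) ^ 2 := fun n j => by
    rw [← lintegral_prod _ (hw n j), eLpNorm_two_sq, ← (measurePreserving_insertNth μ j).map_eq,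
      lintegral_map' _ (measurePreserving_insertNth μ j).measurable.aemeasurable]
    rw [(measurePreserving_insertNth μ j).map_eq]
    exact hm n
  obtain ⟨φ, hφ, hlim⟩ := exists_subseq_ae_tendsto_zero (ν := μ)
    (Ψ := fun n z => ∑ j, ∫⁻ y, w n j (z, y) ∂powMeasure μ k)
    (fun n => Finset.aemeasurable_fun_sum _ fun j _ => (hw n j).lintegral_prod_right') (by
      simp_rw [lintegral_finsetSum' _ fun j _ => (hw _ j).lintegral_prod_right', hint]
      have := tendsto_finsetSum (Finset.univ : Finset (Fin (k + 1))) fun _ _ => ENNReal.Tendsto.pow (n := 2) hg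
      simpa using this)
  refine ⟨φ, hφ, ?_⟩
  have hsym : ∀ᵐ z ∂μ, ∀ j : Fin (k + 1), ∀ᵐ y ∂powMeasure μ k,
      f (j.insertNth (α := fun _ => Z) z y) = f (Fin.cons z y) := by
    refine ae_all_iff.2 fun j => ?_
    have h := (measurePreserving_insertNth μ (0 : Fin (k + 1))).quasiMeasurePreserving.ae
      (hf.2 j.cycleRange)
    filter_upwards [Measure.ae_ae_of_ae_prod h] with z hz
    filter_upwards [hz] with y hy
    simpa [Fin.insertNth_zero, cons_comp_cycleRange] using hy
  filter_upwards [hlim, hsym] with z hz hs j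
  have h2 : Tendsto (fun n => eLpNorm (fun y =>
      ((g (φ n)).slice j z).toFun y - f (Fin.cons z y)) 2 (powMeasure μ k) ^ 2) atTop (𝓝 0) := by
    refine tendsto_of_tendsto_of_tendsto_of_le_of_le tendsto_const_nhds hz
      (fun n => zero_le) fun n => ?_
    refine le_trans (le_of_eq ?_) (Finset.single_le_sum
      (f := fun j => ∫⁻ y, w (φ n) j (z, y) ∂powMeasure μ k) (fun _ _ => zero_le)
      (Finset.mem_univ j))
    dsimp only
    rw [eLpNorm_two_sq]
    refine lintegral_congr_ae ?_
    filter_upwards [hs j] with y hy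
    simp only [w, Elementary.slice_toFun, hy]
  have h3 := (ENNReal.continuous_rpow_const (y := (2 : ℝ)⁻¹)).tendsto 0 |>.comp h2
  simp only [Function.comp_def, ← ENNReal.rpow_natCast, ← ENNReal.rpow_mul] at h3
  simpa using h3

/-- The add-one cost of a multiple integral of order `k + 1` is `k + 1` times the multiple
integral of order `k` of the sections of its kernel. -/
theorem IsMultipleIntegral.addPoint_sub_ae_eq [IsProbabilityMeasure P] [SigmaFinite μ]
    (hP : IsPoissonMeasure μ P) {k : ℕ} {f : (Fin (k + 1) → Z) → ℝ} (hf : IsSymmKernel μ (k + 1) f)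
    {J : Config Z → ℝ} (hJ : IsMultipleIntegral μ P (k + 1) f J) {v : Config Z → Z → ℝ}
    (hvm : AEStronglyMeasurable (fun p : Config Z × Z => v p.1 p.2) (P.prod μ))
    (hv : ∀ᵐ z ∂μ, IsMultipleIntegral μ P k (fun y => f (Fin.cons z y)) fun ω => v ω z) :
    (fun p : Config Z × Z => J (addPoint p) - J p.1) =ᵐ[P.prod μ]
      fun p => ((k + 1 : ℕ) : ℝ) * v p.1 p.2 := by
  have hq := hP.quasiMeasurePreserving_addPoint
  have hJm := hJ.memLp.aestronglyMeasurable
  obtain ⟨g, hgf, hgJ⟩ := hJ.exists_approx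
  have hgm : ∀ n, AEStronglyMeasurable (g n).integral P :=
    fun n => (g n).measurable_integral.aestronglyMeasurable
  obtain ⟨φ, hφ, hφJ⟩ := (tendstoInMeasure_of_tendsto_eLpNorm (p := 2) (by simp)
    hgm hJm hgJ).exists_seq_tendsto_ae
  obtain ⟨ψ, hψ, hslice⟩ := exists_subseq_slice_tendsto hf (hgf.comp hφ.tendsto_atTop)
  refine ae_eq_prod_of_ae_ae_swap
    ((hJm.comp_quasiMeasurePreserving hq).sub
      (hJm.comp_quasiMeasurePreserving Measure.quasiMeasurePreserving_fst))
    (hvm.const_mul _) ?_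
  have hadd := ae_ae_swap_of_ae_prod (hq.ae hφJ)
  have hside : ∀ᵐ ω ∂P, ∀ n i j, ω.1 ((g n).side i j) < ∞ :=
    ae_all_iff.2 fun n => hP.ae_side_lt_top (g n)
  filter_upwards [hslice, hv, hadd] with z hz hvz haz
  have hL2 : Tendsto (fun n => eLpNorm ((fun ω => ∑ j, ((g (φ (ψ n))).slice j z).integral ω) -
      fun ω => ((k + 1 : ℕ) : ℝ) * v ω z) 2 P) atTop (𝓝 0) := by
    have hs := tendsto_finsetSum (Finset.univ : Finset (Fin (k + 1))) fun j _ =>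
      hvz.tendsto_integral hP (hz j)
    rw [Finset.sum_const_zero] at hs
    refine tendsto_of_tendsto_of_tendsto_of_le_of_le tendsto_const_nhds hs
      (fun n => zero_le) fun n => ?_
    have e : ((fun ω => ∑ j, ((g (φ (ψ n))).slice j z).integral ω) -
        fun ω => ((k + 1 : ℕ) : ℝ) * v ω z) =
        ∑ j, fun ω => ((g (φ (ψ n))).slice j z).integral ω - v ω z := by
      ext ω
      simp [Finset.sum_apply]
    rw [e]
    exact eLpNorm_sum_le (fun j _ => ((g (φ (ψ n))).slice j z).measurable_integral
      |>.aestronglyMeasurable.sub hvz.memLp.aestronglyMeasurable) (by norm_num)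
  have hsm : ∀ n, Measurable fun ω => ∑ j, ((g (φ (ψ n))).slice j z).integral ω := fun n =>
    Finset.measurable_sum _ fun j _ => ((g (φ (ψ n))).slice j z).measurable_integral
  have hM := tendstoInMeasure_of_tendsto_eLpNorm (p := 2) (by simp)
    (fun n => (hsm n).aestronglyMeasurable) (hvz.memLp.aestronglyMeasurable.const_mul _) hL2
  -- For fixed `z` the same sums converge almost surely to the add-one cost of `J` and in `L²` to
  -- `(k + 1) v`; limits in measure are unique.
  have hM' : TendstoInMeasure P (fun n ω => ∑ j, ((g (φ (ψ n))).slice j z).integral ω) atTop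
      fun ω => J (addPoint (ω, z)) - J ω := by
    refine tendstoInMeasure_of_tendsto_ae (fun n => (hsm n).aestronglyMeasurable) ?_
    filter_upwards [haz, hφJ, hside] with ω h1 h2 h3
    refine ((h1.sub h2).comp hψ.tendsto_atTop).congr fun n => ?_
    simp only [Function.comp_apply]
    rw [(g _).integral_addPoint (h3 _), add_sub_cancel_left]
  exact tendstoInMeasure_ae_unique hM' hM

/-- The Malliavin derivative is the add-one cost operator. -/
theorem IsMalliavinDeriv.ae_eq_addPoint_sub [IsProbabilityMeasure P] [SigmaFinite μ]
    (hP : IsPoissonMeasure μ P) {F : Config Z → ℝ} {u : Config Z → Z → ℝ}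
    (hu : IsMalliavinDeriv μ P F u) :
    (fun p : Config Z × Z => u p.1 p.2) =ᵐ[P.prod μ] fun p => F (addPoint p) - F p.1 := by
  obtain ⟨f, J, hF, -, hum, v, hvm, hv, hsum⟩ := hu
  have hq := hP.quasiMeasurePreserving_addPoint
  have hJ : ∀ᵐ p ∂P.prod μ, ∀ k, J k (addPoint p) - J k p.1 = ((k + 1 : ℕ) : ℝ) * v k p.1 p.2 :=
    ae_all_iff.2 fun k => (hF.integral k).addPoint_sub_ae_eq hP (hF.symm k)
      (hvm k).aestronglyMeasurable (hv k)
  obtain ⟨φ, hφ, hφF⟩ := (tendstoInMeasure_of_tendsto_eLpNorm (p := 2) (by simp)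
    (f := fun N ω => ∑ k ∈ Finset.range N, J k ω)
    (fun N => Finset.aestronglyMeasurable_fun_sum _ fun k _ =>
      (hF.integral k).memLp.aestronglyMeasurable)
    (hF.memLp.aestronglyMeasurable.sub aestronglyMeasurable_const)
    hF.hasSum).exists_seq_tendsto_ae
  -- Extracted inside `φ`, so that both partial sums converge almost everywhere along one sequence.
  obtain ⟨ψ, hψ, hψu⟩ := (tendstoInMeasure_of_tendsto_eLpNorm (p := 2) (by simp)
    (f := fun N (p : Config Z × Z) =>
      ∑ k ∈ Finset.range (φ N), ((k + 1 : ℕ) : ℝ) * v k p.1 p.2)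
    (fun N => Finset.aestronglyMeasurable_fun_sum _ fun k _ =>
      (hvm k).aestronglyMeasurable.const_mul _)
    hum.aestronglyMeasurable (hsum.comp hφ.tendsto_atTop)).exists_seq_tendsto_ae
  filter_upwards [hJ, hψu, hq.ae hφF,
    Measure.quasiMeasurePreserving_fst.ae hφF] with p h1 h2 h3 h4
  refine tendsto_nhds_unique h2 ?_
  have h5 := (h3.sub h4).comp hψ.tendsto_atTop
  -- The centering constant `E[F]` cancels in the difference.
  simp only [Pi.sub_apply, sub_sub_sub_cancel_right] at h5
  refine h5.congr fun n => ?_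
  simp only [Function.comp_apply, ← Finset.sum_sub_distrib, h1]

lemma aestronglyMeasurable_malliavinD (μ : Measure Z) (P : Measure (Config Z))
    (F : Config Z → ℝ) :
    AEStronglyMeasurable (fun p : Config Z × Z => malliavinD μ P F p.1 p.2) (P.prod μ) := by
  unfold malliavinD
  split_ifs with h
  · obtain ⟨f, J, -, -, hum, -⟩ := h.choose_spec
    exact hum.aestronglyMeasurable
  · exact aestronglyMeasurable_const

/-- The Malliavin derivative of an integer-valued functional is integer-valued. -/
theorem IsPoissonMeasure.ae_malliavinD_int [IsProbabilityMeasure P] [SigmaFinite μ]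
    (hP : IsPoissonMeasure μ P) {F : Config Z → ℝ} (hF : ∀ᵐ ω ∂P, ∃ k : ℕ, F ω = k) :
    ∀ᵐ p ∂P.prod μ, ∃ k : ℤ, malliavinD μ P F p.1 p.2 = k := by
  unfold malliavinD
  split_ifs with h
  · filter_upwards [h.choose_spec.ae_eq_addPoint_sub hP,
      hP.quasiMeasurePreserving_addPoint.ae hF,
      Measure.quasiMeasurePreserving_fst.ae hF] with p h1 ⟨a, ha⟩ ⟨b, hb⟩
    exact ⟨a - b, by rw [h1, ha, hb]; push_cast; rfl⟩
  -- The default value of `malliavinD` is 0, again an integer.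
  · exact ae_of_all _ fun _ => ⟨0, by simp⟩

end PoissonSpace

/-! ### Hölder's inequality with an integer-valued factor, and the conclusion. -/

namespace PoissonSpace

variable {Z : Type*} [MeasurableSpace Z] {μ : Measure Z} {P : Measure (Config Z)}

lemma expMoment_eq_lintegral_prod [SFinite μ] {p : ℝ} (hp : 0 ≤ p) {u : Config Z → Z → ℝ}
    (hu : AEStronglyMeasurable (fun x : Config Z × Z => u x.1 x.2) (P.prod μ)) :
    expMoment μ P p u = ∫⁻ x, ‖u x.1 x.2‖ₑ ^ p ∂P.prod μ := by
  rw [lintegral_prod _ (hu.enorm.pow_const p), expMoment]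
  simp_rw [← ENNReal.ofReal_rpow_of_nonneg (abs_nonneg _) hp, Real.enorm_eq_ofReal_abs]

/-- Hölder's inequality when the second factor is integer-valued. -/
lemma lintegral_mul_le_of_int [SFinite μ] {u w : Config Z → Z → ℝ}
    (hu : AEStronglyMeasurable (fun x : Config Z × Z => u x.1 x.2) (P.prod μ))
    (hw : AEStronglyMeasurable (fun x : Config Z × Z => w x.1 x.2) (P.prod μ))
    (hwi : ∀ᵐ x ∂P.prod μ, ∃ k : ℤ, w x.1 x.2 = k) {ε : ℝ} (hε : 1 < ε) :
    ∫⁻ ω, ∫⁻ z, ENNReal.ofReal (|u ω z| * |w ω z|) ∂μ ∂P ≤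
      expMoment μ P (1 + ε) u ^ (1 / (1 + ε)) * expMoment μ P 2 w ^ (ε / (1 + ε)) := by
  have hε0 : 0 < ε := by linarith
  have hpq : (1 + ε).HolderConjugate ((1 + ε) / ε) := by
    rw [Real.holderConjugate_iff]
    refine ⟨by linarith, ?_⟩
    field_simp
  rw [expMoment_eq_lintegral_prod (by linarith) hu, expMoment_eq_lintegral_prod (by norm_num) hw]
  have hl : ∫⁻ ω, ∫⁻ z, ENNReal.ofReal (|u ω z| * |w ω z|) ∂μ ∂P =
      ∫⁻ x, ‖u x.1 x.2‖ₑ * ‖w x.1 x.2‖ₑ ∂P.prod μ := by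
    rw [lintegral_prod (fun x : Config Z × Z => ‖u x.1 x.2‖ₑ * ‖w x.1 x.2‖ₑ)
      (hu.enorm.mul hw.enorm)]
    simp_rw [ENNReal.ofReal_mul (abs_nonneg _), Real.enorm_eq_ofReal_abs]
  rw [hl]
  refine (ENNReal.lintegral_mul_le_Lp_mul_Lq _ hpq hu.enorm hw.enorm).trans ?_
  rw [one_div_div]
  gcongr ?_ * ?_ ^ _
  · exact le_rfl
  refine lintegral_mono_ae ?_
  filter_upwards [hwi] with x ⟨k, hk⟩
  rw [hk]
  -- An integer is 0 or at least 1 in modulus, so powers increase with the exponent; `(1+ε)/ε ≤ 2`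
  -- follows from `ε > 1`.
  rcases eq_or_ne k 0 with rfl | hk0
  · simp only [Int.cast_zero, enorm_zero]
    rw [ENNReal.zero_rpow_of_pos (by positivity)]
    exact zero_le
  · refine ENNReal.rpow_le_rpow_of_exponent_le ?_ ?_
    · rw [Real.enorm_eq_ofReal_abs, ← ENNReal.ofReal_one]
      exact ENNReal.ofReal_le_ofReal (by exact_mod_cast Int.one_le_abs hk0)
    · rw [div_le_iff₀ hε0]
      linarith

end PoissonSpace

theorem proposition2p2 {Z : ℕ → Type*} [∀ n, MeasurableSpace (Z n)]
    [∀ n, StandardBorelSpace (Z n)]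
    (μ : (n : ℕ) → Measure (Z n)) [∀ n, SigmaFinite (μ n)] [∀ n, NullSingletonClass (μ n)]
    (P : (n : ℕ) → Measure (PoissonSpace.Config (Z n))) [∀ n, IsProbabilityMeasure (P n)]
    (hP : ∀ n, PoissonSpace.IsPoissonMeasure (μ n) (P n))
    (d m : ℕ)
    (F : (n : ℕ) → Fin d → PoissonSpace.Config (Z n) → ℝ)
    (G : (n : ℕ) → Fin m → PoissonSpace.Config (Z n) → ℝ)
    (hF : ∀ n i, F n i ∈ PoissonSpace.domD (μ n) (P n))
    (hF_nat : ∀ n i, ∀ᵐ ω ∂(P n), ∃ k : ℕ, F n i ω = k)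
    (hG : ∀ n j, G n j ∈ PoissonSpace.domD (μ n) (P n))
    (hG_centered : ∀ n j, ∫ ω, G n j ω ∂(P n) = 0)
    (h_bounded : ∀ i, ∃ C : ℝ≥0, ∀ n,
      PoissonSpace.expMoment (μ n) (P n) 2 (PoissonSpace.malliavinD (μ n) (P n) (F n i)) ≤ C)
    (h_lim : ∃ ε : ℝ, 1 < ε ∧ ∀ j, Tendsto (fun n =>
      PoissonSpace.expMoment (μ n) (P n) (1 + ε)
        (PoissonSpace.malliavinD (μ n) (P n) (PoissonSpace.pseudoInverseL (μ n) (P n) (G n j))))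
      atTop (𝓝 0)) :
    Tendsto (fun n => PoissonSpace.beta (μ n) (P n) (F n) (G n)) atTop (𝓝 0) := by
  obtain ⟨ε, hε, hlim⟩ := h_lim
  have hsum : (∑ _ : Fin d, ∑ _ : Fin m, (0 : ℝ≥0∞)) = 0 := by simp
  rw [← hsum]
  refine tendsto_finsetSum _ fun i _ => tendsto_finsetSum _ fun j _ => ?_
  obtain ⟨C, hC⟩ := h_bounded i
  have hε' : 0 < 1 + ε := by linarith
  have hpow : Tendsto (fun n => PoissonSpace.expMoment (μ n) (P n) (1 + ε)
      (PoissonSpace.malliavinD (μ n) (P n) (PoissonSpace.pseudoInverseL (μ n) (P n) (G n j))) ^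
        (1 / (1 + ε)) * (C : ℝ≥0∞) ^ (ε / (1 + ε))) atTop (𝓝 0) := by
    have h1 := ((ENNReal.continuous_rpow_const (y := 1 / (1 + ε))).tendsto 0).comp (hlim j)
    rw [ENNReal.zero_rpow_of_pos (by positivity)] at h1
    have h2 := ENNReal.Tendsto.mul_const (b := (C : ℝ≥0∞) ^ (ε / (1 + ε))) h1
      (Or.inr (ENNReal.rpow_ne_top_of_nonneg (by positivity) ENNReal.coe_ne_top))
    simpa using h2
  refine tendsto_of_tendsto_of_tendsto_of_le_of_le tendsto_const_nhds hpow
    (fun n => zero_le) fun n => ?_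
  refine (PoissonSpace.lintegral_mul_le_of_int
    (PoissonSpace.aestronglyMeasurable_malliavinD _ _ _)
    (PoissonSpace.aestronglyMeasurable_malliavinD _ _ _)
    ((hP n).ae_malliavinD_int (hF_nat n i)) hε).trans ?_
  gcongr
  exact hC n
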